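/- Let $b$ be a positive integer and let $\mathbb Z[1/b]\subset\mathbb Q$. With $(x;y)_k=\prod_{j=1}^k(1-xy^{j-1})$ put $$\mathcal R_b=\varprojlim_k \mathbb Z[1/b][q]/((q;q^2)_k),\qquad \mathcal S_b=\varprojlim_k \mathbb Z[1/b][q]/((q;q)_k).$$ For a set $S$ of positive integers let $\mathbb Z[1/b][q]^S=\varprojlim_{f} \mathbb Z[1/b][q]/(f(q))$, where $f$ runs over the multiplicative set in $\mathbb Z[q]$ generated by the cyclotomic polynomials $\Phi_n(q)$, $n\in S$, directed by divisibility. Setting $q=\xi$ defines evaluation maps $\operatorname{ev}_\xi$ into $\mathbb Z[1/b][\xi]\subset\mathbb C$: on $\mathbb Z[1/b][q]^S$ for every complex root of unity $\xi$ with order in $S$, on $\mathcal R_b$ for every $\xi$ of odd order, and on $\mathcal S_b$ for every root of unity $\xi$. Let $p_1,\dots,p_m$ be the distinct odd prime divisors of $b$. For $\mathbf n=(n_1,\dots,n_m)$ with integers $n_i\ge 0$ let $\mathbf p^{\mathbf n}=\prod_i p_i^{n_i}$, let $A_{\mathbf n}$ be the set of the products of $\mathbf p^{\mathbf n}$ with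 a positive integer coprime to $b$, and let $O_{\mathbf n}$ be the set of the products of $\mathbf p^{\mathbf n}$ with a positive integer coprime to $2b$. (a) Let $S=O_{\mathbf n}$ or $S=A_{\mathbf n}$ for some $\mathbf n$, and let $T$ be either an infinite set of powers of one odd prime not dividing $b$, or an infinite set of odd primes not dividing $b$. If $f,g\in\mathbb Z[1/b][q]^{S}$ satisfy $\operatorname{ev}_\xi(f)=\operatorname{ev}_\xi(g)$ for every root of unity $\xi$ whose order lies in $\mathbf p^{\mathbf n}T$, then $f=g$. (b) Let $p$ be an odd prime not dividing $b$, and let $T$ be the set of all integers of the form $p^kb'$, where $k\ge 0$ and $b'$ is an odd divisor of $b^n$ for some $n\ge 0$. If $f,g\in\mathcal R_b$ satisfy $\operatorname{ev}_\xi(f)=\operatorname{ev}_\xi(g)$ for every root of unity $\xi$ whose order lies in $T$, then $f=g$. If $b$ is odd, the same holds for $f,g\in\mathcal S_b$. -/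

import Mathlib

open Polynomial

namespace CyclotomicCompletion

section InverseLimit

variable {A I : Type} [CommRing A] [Preorder I]

/-- The inverse limit `lim_{i ∈ I} A / J i`, as the ring of compatible families, for a family of
ideals with `J j ≤ J i` whenever `i ≤ j`; the transition maps are the canonical projections
`A / J j → A / J i`. -/
def inverseLimit (J : I → Ideal A) (hJ : Antitone J) : Subring (∀ i, A ⧸ J i) where
  carrier := {x | ∀ (i j : I) (h : i ≤ j), Ideal.Quotient.factor (hJ h) (x j) = x i}
  mul_mem' hx hy i j h := by simp [hx i j h, hy i j h]
  one_mem' i j h := by simp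
  add_mem' hx hy i j h := by simp [hx i j h, hy i j h]
  zero_mem' i j h := by simp
  neg_mem' hx i j h := by simp [hx i j h]

end InverseLimit

section Evaluation

variable {R I : Type} [CommRing R] [Algebra R ℂ] [Preorder I]

/-- Evaluation `q ↦ ξ` on `lim_i R[q] / J i`, through a component `R[q] / J i` such that all
polynomials in `J i` vanish at `ξ`. Its values lie in the subring `R[ξ]` of `ℂ`. -/
noncomputable def evalThrough {J : I → Ideal R[X]} (hJ : Antitone J) (ξ : ℂ) (i : I)
    (hi : ∀ f ∈ J i, aeval ξ f = 0) : inverseLimit J hJ →+* ℂ :=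
  ((Ideal.Quotient.lift (J i) (aeval ξ : R[X] →ₐ[R] ℂ).toRingHom hi).comp
    (Pi.evalRingHom (fun i => R[X] ⧸ J i) i)).comp (inverseLimit J hJ).subtype

/-- The evaluation does not depend on the component that is used. -/
theorem evalThrough_eq_of_le {J : I → Ideal R[X]} (hJ : Antitone J) (ξ : ℂ) {i j : I}
    (hij : i ≤ j) (hi : ∀ f ∈ J i, aeval ξ f = 0) (hj : ∀ f ∈ J j, aeval ξ f = 0)
    (x : inverseLimit J hJ) : evalThrough hJ ξ i hi x = evalThrough hJ ξ j hj x := by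
  obtain ⟨x, hx⟩ := x
  have h := hx i j hij
  obtain ⟨f, hf⟩ := Ideal.Quotient.mk_surjective (x j)
  rw [← hf, Ideal.Quotient.factor_mk] at h
  simp [evalThrough, ← hf, ← h]

end Evaluation

section CyclotomicCompletion

/-- The multiplicative set `Φ*_S` in `ℤ[q]` generated by the cyclotomic polynomials `Φ_n`,
`n ∈ S`. -/
noncomputable def cycMonoid (S : Set ℕ+) : Submonoid ℤ[X] :=
  Submonoid.closure {f | ∃ n ∈ S, f = cyclotomic (n : ℕ) ℤ}

/-- `Φ*_S` is directed with respect to divisibility in `ℤ[q]`. -/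
instance cycMonoidPreorder (S : Set ℕ+) : Preorder (cycMonoid S) where
  le f g := (f : ℤ[X]) ∣ (g : ℤ[X])
  le_refl f := dvd_refl (f : ℤ[X])
  le_trans _ _ _ h₁ h₂ := dvd_trans h₁ h₂

variable (R : Type) [CommRing R]

/-- The principal ideal `(f(q))` of `R[q]`, for `f ∈ Φ*_S`. -/
noncomputable def cycIdeal (S : Set ℕ+) (f : cycMonoid S) : Ideal R[X] :=
  Ideal.span {(f : ℤ[X]).map (Int.castRingHom R)}

theorem cycIdeal_antitone (S : Set ℕ+) : Antitone (cycIdeal R S) := fun f g h =>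
  Ideal.span_singleton_le_span_singleton.mpr
    (Polynomial.map_dvd (Int.castRingHom R) (show (f : ℤ[X]) ∣ (g : ℤ[X]) from h))

/-- The `S`-cyclotomic completion `R[q]^S = lim_{f ∈ Φ*_S} R[q] / (f(q))`. -/
abbrev Completion (S : Set ℕ+) : Type := inverseLimit (cycIdeal R S) (cycIdeal_antitone R S)

variable {R}

/-- Evaluation of elements of `R[q]^S` at a root of unity `ξ` whose order `n` lies in `S`, through
the component `R[q] / (Φ_n(q))`. -/
noncomputable def Completion.ev [Algebra R ℂ] {S : Set ℕ+} {n : ℕ+} (hn : n ∈ S) {ξ : ℂ}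
    (hξ : IsPrimitiveRoot ξ n) : Completion R S →+* ℂ :=
  evalThrough (cycIdeal_antitone R S) ξ
    ⟨cyclotomic (n : ℕ) ℤ, Submonoid.subset_closure ⟨n, hn, rfl⟩⟩ (by
      intro f hf
      obtain ⟨g, rfl⟩ := Ideal.mem_span_singleton.mp hf
      have h : IsRoot (cyclotomic (n : ℕ) ℂ) ξ := hξ.isRoot_cyclotomic n.pos
      have h' : aeval ξ (cyclotomic (n : ℕ) R) = 0 := by
        rw [aeval_def, eval₂_eq_eval_map, map_cyclotomic]
        exact h
      simp [h'])

end CyclotomicCompletion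

section Rings

/-- The `q`-Pochhammer symbol `(x; y)_k = ∏_{j=1}^{k} (1 - x y^{j-1})`. -/
def qPochhammer {A : Type} [CommRing A] (x y : A) (k : ℕ) : A :=
  ∏ j ∈ Finset.range k, (1 - x * y ^ j)

theorem qPochhammer_dvd {A : Type} [CommRing A] (x y : A) {k l : ℕ} (h : k ≤ l) :
    qPochhammer x y k ∣ qPochhammer x y l :=
  Finset.prod_dvd_prod_of_subset _ _ _ (Finset.range_mono h)

/-- The ring `ℤ[1/b]`, as a subring of `ℚ`. -/
abbrev ZInv (b : ℕ) : Type := Algebra.adjoin ℤ {((b : ℚ))⁻¹}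

theorem pochhammerIdeal_antitone (b : ℕ) (x y : (ZInv b)[X]) :
    Antitone fun k : ℕ => Ideal.span {qPochhammer x y k} := fun _ _ h =>
  Ideal.span_singleton_le_span_singleton.mpr (qPochhammer_dvd x y h)

/-- `R_b = lim_k ℤ[1/b][q] / ((q; q²)_k)`. -/
abbrev RRing (b : ℕ) : Type :=
  inverseLimit (fun k : ℕ => Ideal.span {qPochhammer (X : (ZInv b)[X]) (X ^ 2) k})
    (pochhammerIdeal_antitone b X (X ^ 2))

/-- `S_b = lim_k ℤ[1/b][q] / ((q; q)_k)`. -/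
abbrev SRing (b : ℕ) : Type :=
  inverseLimit (fun k : ℕ => Ideal.span {qPochhammer (X : (ZInv b)[X]) X k})
    (pochhammerIdeal_antitone b X X)

/-- Evaluation of elements of `R_b` at a root of unity `ξ` of odd order `n`, through the
component `k = n`; note that `1 - q ^ n` divides `(q; q²)_n`. -/
noncomputable def RRing.ev (b : ℕ) {n : ℕ+} (hn : Odd (n : ℕ)) {ξ : ℂ}
    (hξ : IsPrimitiveRoot ξ n) : RRing b →+* ℂ :=
  evalThrough (pochhammerIdeal_antitone b X (X ^ 2)) ξ (n : ℕ) (by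
    intro f hf
    obtain ⟨g, rfl⟩ := Ideal.mem_span_singleton.mp hf
    obtain ⟨m, hm⟩ := hn
    have h : ∏ j ∈ Finset.range (n : ℕ), (1 - ξ * (ξ ^ 2) ^ j) = 0 := by
      refine Finset.prod_eq_zero (i := m) (Finset.mem_range.mpr (by omega)) ?_
      have h1 := hξ.pow_eq_one
      rw [hm] at h1
      rw [← pow_mul, ← pow_succ', h1, sub_self]
    simp [qPochhammer, h])

/-- Evaluation of elements of `S_b` at a root of unity `ξ` of order `n`, through the component
`k = n`; note that `1 - q ^ n` divides `(q; q)_n`. -/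
noncomputable def SRing.ev (b : ℕ) {n : ℕ+} {ξ : ℂ}
    (hξ : IsPrimitiveRoot ξ n) : SRing b →+* ℂ :=
  evalThrough (pochhammerIdeal_antitone b X X) ξ (n : ℕ) (by
    intro f hf
    obtain ⟨g, rfl⟩ := Ideal.mem_span_singleton.mp hf
    have hn : 0 < (n : ℕ) := n.pos
    have h : ∏ j ∈ Finset.range (n : ℕ), (1 - ξ * ξ ^ j) = 0 := by
      refine Finset.prod_eq_zero (i := (n : ℕ) - 1) (Finset.mem_range.mpr (by omega)) ?_
      rw [← pow_succ', Nat.sub_add_cancel hn, hξ.pow_eq_one, sub_self]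
    simp [qPochhammer, h])

end Rings

section IndexSets

/-- `∏ ℓ ^ (e ℓ)` over the odd prime divisors `ℓ` of `b`; only the exponents `e ℓ` at these
primes matter. -/
def oddPrimePower (b : ℕ) (e : ℕ → ℕ) : ℕ := ∏ ℓ ∈ b.primeFactors.erase 2, ℓ ^ e ℓ

/-- The positive integers that are coprime to `a`. -/
def coprimeTo (a : ℕ) : Set ℕ+ := {n | Nat.Coprime a n}

/-- `A_e`: the products of `oddPrimePower b e` with a positive integer coprime to `b`. -/
def setA (b : ℕ) (e : ℕ → ℕ) : Set ℕ+ :=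
  {n | ∃ m ∈ coprimeTo b, (n : ℕ) = oddPrimePower b e * m}

/-- `O_e`: the products of `oddPrimePower b e` with a positive integer coprime to `2 b`. -/
def setO (b : ℕ) (e : ℕ → ℕ) : Set ℕ+ :=
  {n | ∃ m ∈ coprimeTo (2 * b), (n : ℕ) = oddPrimePower b e * m}

/-- Infinite sets of powers of one odd prime that does not divide `b`. -/
def IsInfinitePowerSet (b : ℕ) (T : Set ℕ) : Prop :=
  T.Infinite ∧ ∃ p : ℕ, p.Prime ∧ Odd p ∧ ¬ p ∣ b ∧ ∀ t ∈ T, ∃ k : ℕ, t = p ^ k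

/-- Infinite sets of odd primes that do not divide `b`. -/
def IsInfinitePrimeSet (b : ℕ) (P : Set ℕ) : Prop :=
  P.Infinite ∧ ∀ p ∈ P, p.Prime ∧ Odd p ∧ ¬ p ∣ b

/-- The integers `p ^ k * b'` with `k ≥ 0` and `b'` an odd divisor of some power of `b`. -/
def orderSet (p b : ℕ) : Set ℕ :=
  {t | ∃ k b' : ℕ, Odd b' ∧ (∃ n : ℕ, b' ∣ b ^ n) ∧ t = p ^ k * b'}

end IndexSets

end CyclotomicCompletion

open CyclotomicCompletion

/-! Passing to the difference, an element vanishing at the given orders must be zero. All moduli are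
products of powers of cyclotomic polynomials, which are monic and pairwise coprime over `ℚ`, so it
suffices that the residues modulo each `Φ_n ^ k` vanish.

The engine is `IsCompatible.vanishes_pow`. Let the residues modulo `P ^ k` and `h` be zero, with `h`
coprime to `P` over `ℚ` and `h = c u + P v`. Then a representative is a multiple of `P ^ k h`, which
is `c P ^ k u` modulo `P ^ (k + 1)`; hence `c` divides the residue modulo `P ^ (k + 1)`. A nonzero
element of `ℤ[1/b]` has only bounded divisors coprime to `b`, so arbitrarily large `c` force the
residue to be zero.

Pairs `(h, c)` come from `Φ_{n p^k} ≡ Φ_n ^ e` modulo `p`, read in two ways. For infinitely many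
prime powers `t`, the product of the `Φ_{N t}` gives vanishing to all orders at `N`. Conversely,
high powers of `Φ_n` carry vanishing to all orders from `n` to `n p`, for `p` prime to `b`, and so
from `N` to every `N m` with `m` coprime to `b`. In (a) one `N` serves all of `S`; in (b) `N` is the
part of `n` composed of primes dividing `b`. -/

namespace CyclotomicCompletion

/-! ### Divisibility in `ℤ[1/b]` and `ℤ[1/b][q]` -/

section Divisibility

theorem ZInv.algebraMap_injective (b : ℕ) : Function.Injective (algebraMap (ZInv b) ℚ) :=
  Subtype.val_injective

theorem ZInv.exists_pow_mul_eq_intCast {b : ℕ} (hb : 0 < b) (x : ZInv b) :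
    ∃ (n : ℕ) (a : ℤ), (b : ℚ) ^ n * (x : ℚ) = a := by
  have hb' : (b : ℚ) ≠ 0 := by positivity
  obtain ⟨x, hx⟩ := x
  simp only
  induction hx using Algebra.adjoin_induction with
  | mem x hx =>
    rw [Set.mem_singleton_iff] at hx
    exact ⟨1, 1, by simp [hx, hb']⟩
  | algebraMap r => exact ⟨0, r, by simp⟩
  | add x y _ _ h₁ h₂ =>
    obtain ⟨n, a, h₁⟩ := h₁
    obtain ⟨m, c, h₂⟩ := h₂
    refine ⟨n + m, a * b ^ m + c * b ^ n, ?_⟩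
    push_cast
    rw [← h₁, ← h₂]
    ring
  | mul x y _ _ h₁ h₂ =>
    obtain ⟨n, a, h₁⟩ := h₁
    obtain ⟨m, c, h₂⟩ := h₂
    refine ⟨n + m, a * c, ?_⟩
    push_cast
    rw [← h₁, ← h₂]
    ring

/-- An element of `ℤ[1/b]` with arbitrarily large divisors coprime to `b` is zero. -/
theorem ZInv.eq_zero_of_forall_dvd {b : ℕ} (hb : 0 < b) {x : ZInv b}
    (h : ∀ C : ℕ, ∃ c : ℕ, C < c ∧ c.Coprime b ∧ (c : ZInv b) ∣ x) : x = 0 := by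
  obtain ⟨n, a, ha⟩ := exists_pow_mul_eq_intCast hb x
  obtain ⟨c, hc, hcb, y, rfl⟩ := h a.natAbs
  obtain ⟨m, d, hd⟩ := exists_pow_mul_eq_intCast hb y
  have h₁ : (b : ℤ) ^ m * a = c * (b ^ n * d) := by
    have : (b : ℚ) ^ m * a = c * (b ^ n * d) := by
      rw [← ha, ← hd]
      push_cast
      ring
    exact_mod_cast this
  have h₂ : (c : ℤ) ∣ a := by
    have hco : IsCoprime (c : ℤ) ((b : ℤ) ^ m) := (Nat.isCoprime_iff_coprime.mpr hcb).pow_right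
    exact hco.dvd_of_dvd_mul_left ⟨_, h₁⟩
  have h₃ : a = 0 := by
    refine Int.eq_zero_of_abs_lt_dvd h₂ ?_
    rw [Int.abs_eq_natAbs]
    exact_mod_cast hc
  rw [h₃] at ha
  have hb' : (b : ℚ) ^ n ≠ 0 := by positivity
  refine Subtype.ext ?_
  simpa [hb.ne'] using ha

/-- Division by a monic polynomial is unaffected by an injective extension of scalars. This gives
access to coprimality over `ℚ`, which can fail to be comaximality over `ℤ[1/b]`. -/
theorem map_intCast_dvd_iff {b : ℕ} {h : ℤ[X]} (hm : h.Monic) {F : (ZInv b)[X]} :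
    h.map (Int.castRingHom (ZInv b)) ∣ F ↔
      h.map (Int.castRingHom ℚ) ∣ F.map (algebraMap (ZInv b) ℚ) := by
  rw [← map_dvd_map _ (ZInv.algebraMap_injective b) (hm.map _), Polynomial.map_map,
    RingHom.ext_int ((algebraMap (ZInv b) ℚ).comp (Int.castRingHom (ZInv b))) (Int.castRingHom ℚ)]

theorem map_mul_dvd_of_isCoprime {b : ℕ} {h₁ h₂ : ℤ[X]} (hm₁ : h₁.Monic) (hm₂ : h₂.Monic)
    (hc : IsCoprime (h₁.map (Int.castRingHom ℚ)) (h₂.map (Int.castRingHom ℚ)))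
    {F : (ZInv b)[X]} (hd₁ : h₁.map (Int.castRingHom (ZInv b)) ∣ F)
    (hd₂ : h₂.map (Int.castRingHom (ZInv b)) ∣ F) :
    (h₁ * h₂).map (Int.castRingHom (ZInv b)) ∣ F := by
  rw [map_intCast_dvd_iff hm₁] at hd₁
  rw [map_intCast_dvd_iff hm₂] at hd₂
  rw [map_intCast_dvd_iff (hm₁.mul hm₂), Polynomial.map_mul]
  exact hc.mul_dvd hd₁ hd₂

theorem map_prod_dvd_of_isCoprime {ι : Type} {b : ℕ} {s : Finset ι} {h : ι → ℤ[X]}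
    (hm : ∀ i ∈ s, (h i).Monic)
    (hc : (s : Set ι).Pairwise
      (Function.onFun IsCoprime fun i => (h i).map (Int.castRingHom ℚ)))
    {F : (ZInv b)[X]} (hd : ∀ i ∈ s, (h i).map (Int.castRingHom (ZInv b)) ∣ F) :
    (∏ i ∈ s, h i).map (Int.castRingHom (ZInv b)) ∣ F := by
  rw [map_intCast_dvd_iff (monic_prod_of_monic _ _ hm), Polynomial.map_prod]
  exact Finset.prod_dvd_of_coprime hc fun i hi => (map_intCast_dvd_iff (hm i hi)).mp (hd i hi)

theorem isCoprime_map_cyclotomic {n m : ℕ} (h : n ≠ m) :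
    IsCoprime ((cyclotomic n ℤ).map (Int.castRingHom ℚ))
      ((cyclotomic m ℤ).map (Int.castRingHom ℚ)) := by
  simpa only [map_cyclotomic] using cyclotomic.isCoprime_rat h

end Divisibility

/-! ### Congruences between cyclotomic polynomials modulo a prime -/

section CyclotomicCongruence

theorem natCast_dvd_adjoinRoot_mk_iff {c : ℕ} {P h : ℤ[X]} :
    (c : AdjoinRoot P) ∣ AdjoinRoot.mk P h ↔ ∃ u v : ℤ[X], h = c * u + P * v := by
  constructor
  · rintro ⟨w, hw⟩
    obtain ⟨u, rfl⟩ := AdjoinRoot.mk_surjective w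
    have : AdjoinRoot.mk P h = AdjoinRoot.mk P (c * u) := by simpa using hw
    obtain ⟨v, hv⟩ := AdjoinRoot.mk_eq_mk.mp this
    exact ⟨u, v, by rw [← hv]; ring⟩
  · rintro ⟨u, v, rfl⟩
    simp

theorem natCast_dvd_of_map_zmod_eq {p : ℕ} {f g : ℤ[X]}
    (h : f.map (Int.castRingHom (ZMod p)) = g.map (Int.castRingHom (ZMod p))) :
    (p : ℤ[X]) ∣ f - g := by
  have h' : (C (p : ℤ) : ℤ[X]) ∣ f - g := by
    rw [C_dvd_iff_dvd_coeff]
    intro i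
    rw [← ZMod.intCast_zmod_eq_zero_iff_dvd]
    have := congrArg (fun F => F.coeff i) h
    simp only [coeff_map, eq_intCast] at this
    simp [this]
  simpa using h'

/-- `Φ_{n p^k} ≡ Φ_n^e` modulo `p`, for some `e > 0`. -/
theorem exists_cyclotomic_mul_prime_pow_zmod {p : ℕ} (hp : p.Prime) (n k : ℕ) :
    ∃ e, 0 < e ∧ cyclotomic (n * p ^ k) (ZMod p) = cyclotomic n (ZMod p) ^ e := by
  have := Fact.mk hp
  induction k with
  | zero => exact ⟨1, one_pos, by simp⟩
  | succ k ih =>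
    obtain ⟨e, he, ih⟩ := ih
    rw [pow_succ, ← mul_assoc]
    -- Modulo `p`, `Φ_{m p}` is `Φ_m ^ p` or `Φ_m ^ (p - 1)`, according to whether `p` divides `m`.
    by_cases h : p ∣ n * p ^ k
    · exact ⟨e * p, Nat.mul_pos he hp.pos, by
        rw [cyclotomic_mul_prime_dvd_eq_pow _ h, ih, pow_mul]⟩
    · exact ⟨e * (p - 1), Nat.mul_pos he (Nat.sub_pos_of_lt hp.one_lt), by
        rw [cyclotomic_mul_prime_eq_pow_of_not_dvd _ h, ih, pow_mul]⟩

theorem natCast_dvd_mk_cyclotomic_mul_prime_pow {p : ℕ} (hp : p.Prime) (n k : ℕ) :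
    (p : AdjoinRoot (cyclotomic n ℤ)) ∣
      AdjoinRoot.mk (cyclotomic n ℤ) (cyclotomic (n * p ^ k) ℤ) := by
  obtain ⟨e, he, h⟩ := exists_cyclotomic_mul_prime_pow_zmod hp n k
  obtain ⟨u, hu⟩ := natCast_dvd_of_map_zmod_eq (p := p)
    (f := cyclotomic (n * p ^ k) ℤ) (g := cyclotomic n ℤ ^ e) (by simpa using h)
  obtain ⟨v, hv⟩ := dvd_pow_self (cyclotomic n ℤ) he.ne'
  rw [natCast_dvd_adjoinRoot_mk_iff]
  exact ⟨u, v, by rw [← hv, ← hu]; ring⟩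

/-- The same congruence read modulo `Φ_{n p}`: it lets vanishing climb from `n` to `n p`. -/
theorem exists_natCast_dvd_mk_cyclotomic_pow {p : ℕ} (hp : p.Prime) (n : ℕ) :
    ∃ e, (p : AdjoinRoot (cyclotomic (n * p) ℤ)) ∣
      AdjoinRoot.mk (cyclotomic (n * p) ℤ) (cyclotomic n ℤ ^ e) := by
  obtain ⟨e, -, h⟩ := exists_cyclotomic_mul_prime_pow_zmod hp n 1
  rw [pow_one] at h
  obtain ⟨u, hu⟩ := natCast_dvd_of_map_zmod_eq (p := p)
    (f := cyclotomic n ℤ ^ e) (g := cyclotomic (n * p) ℤ) (by simpa using h.symm)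
  refine ⟨e, natCast_dvd_adjoinRoot_mk_iff.mpr ⟨u, 1, ?_⟩⟩
  rw [← hu]
  ring

end CyclotomicCongruence

end CyclotomicCompletion

namespace CyclotomicCompletion

/-! ### Propagation of vanishing between residues -/

section Residues

theorem cyclotomic_mem_cycMonoid {S : Set ℕ+} {n : ℕ+} (hn : n ∈ S) :
    cyclotomic (n : ℕ) ℤ ∈ cycMonoid S :=
  Submonoid.subset_closure ⟨n, hn, rfl⟩

theorem monic_of_mem_cycMonoid {S : Set ℕ+} {h : ℤ[X]} (hh : h ∈ cycMonoid S) : h.Monic := by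
  induction hh using Submonoid.closure_induction with
  | mem x hx =>
    obtain ⟨n, -, rfl⟩ := hx
    exact cyclotomic.monic _ _
  | one => exact monic_one
  | mul x y _ _ hx hy => exact hx.mul hy

/-- Collecting equal factors makes the remaining ones pairwise coprime over `ℚ`. -/
theorem exists_eq_prod_of_mem_cycMonoid {S : Set ℕ+} {h : ℤ[X]} (hh : h ∈ cycMonoid S) :
    ∃ e : ℕ+ →₀ ℕ, (∀ n ∈ e.support, n ∈ S) ∧ h = e.prod fun n k => cyclotomic (n : ℕ) ℤ ^ k := by
  induction hh using Submonoid.closure_induction with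
  | mem x hx =>
    obtain ⟨n, hn, rfl⟩ := hx
    refine ⟨Finsupp.single n 1, fun m hm => ?_, by simp⟩
    rwa [Finset.mem_singleton.mp (Finsupp.support_single_subset hm)]
  | one => exact ⟨0, by simp, by simp⟩
  | mul x y _ _ hx hy =>
    obtain ⟨e, he, rfl⟩ := hx
    obtain ⟨d, hd, rfl⟩ := hy
    refine ⟨e + d, fun n hn => ?_, ?_⟩
    · rcases Finset.mem_union.mp (Finsupp.support_add hn) with h | h
      exacts [he n h, hd n h]
    · rw [Finsupp.prod_add_index' (by simp) (by intros; rw [pow_add])]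

/-- `F h`, for `h ∈ Φ*_S`, represent the residues in `ℤ[1/b][q] / (h)` of one element of the
completion. -/
def IsCompatible (b : ℕ) (S : Set ℕ+) (F : ℤ[X] → (ZInv b)[X]) : Prop :=
  ∀ h ∈ cycMonoid S, ∀ h' ∈ cycMonoid S, h' ∣ h →
    h'.map (Int.castRingHom (ZInv b)) ∣ F h - F h'

/-- The residue modulo `h` vanishes. -/
def Vanishes {b : ℕ} (F : ℤ[X] → (ZInv b)[X]) (h : ℤ[X]) : Prop :=
  h.map (Int.castRingHom (ZInv b)) ∣ F h

variable {b : ℕ} {S : Set ℕ+} {F : ℤ[X] → (ZInv b)[X]}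

theorem IsCompatible.dvd_iff (hF : IsCompatible b S F) {h h' : ℤ[X]} (hh : h ∈ cycMonoid S)
    (hh' : h' ∈ cycMonoid S) (hd : h' ∣ h) :
    h'.map (Int.castRingHom (ZInv b)) ∣ F h ↔ Vanishes F h' :=
  dvd_iff_dvd_of_dvd_sub (hF h hh h' hh' hd)

theorem IsCompatible.vanishes_prod (hF : IsCompatible b S F) {ι : Type} {s : Finset ι}
    {h : ι → ℤ[X]} (hm : ∀ i ∈ s, h i ∈ cycMonoid S)
    (hc : (s : Set ι).Pairwise
      (Function.onFun IsCoprime fun i => (h i).map (Int.castRingHom ℚ)))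
    (hv : ∀ i ∈ s, Vanishes F (h i)) : Vanishes F (∏ i ∈ s, h i) :=
  map_prod_dvd_of_isCoprime (fun i hi => monic_of_mem_cycMonoid (hm i hi)) hc fun i hi =>
    (hF.dvd_iff (prod_mem hm) (hm i hi) (Finset.dvd_prod_of_mem h hi)).mpr (hv i hi)

/-- An element vanishes modulo all powers of `P` as soon as it vanishes modulo some `h`, coprime to
`P` over `ℚ`, that lie in `(c, P)` for arbitrarily large integers `c` coprime to `b`. -/
theorem IsCompatible.vanishes_pow (hF : IsCompatible b S F) (hb : 0 < b) {P : ℤ[X]}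
    (hP : P ∈ cycMonoid S)
    (H : ∀ N : ℕ, ∃ c : ℕ, N < c ∧ c.Coprime b ∧ ∃ h ∈ cycMonoid S, Vanishes F h ∧
      IsCoprime (h.map (Int.castRingHom ℚ)) (P.map (Int.castRingHom ℚ)) ∧
      (c : AdjoinRoot P) ∣ AdjoinRoot.mk P h) (k : ℕ) :
    Vanishes F (P ^ k) := by
  induction k with
  | zero => simp [Vanishes]
  | succ k ih =>
    have hmem := pow_mem hP
    have hQ : ((P ^ (k + 1)).map (Int.castRingHom (ZInv b))).Monic :=
      (monic_of_mem_cycMonoid (hmem _)).map _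
    -- The remainder by the monic `P ^ (k + 1)` is a canonical representative, so the divisibility
    -- argument can be run on its coefficients.
    rw [Vanishes, ← modByMonic_eq_zero_iff_dvd hQ]
    ext1 i
    rw [coeff_zero]
    refine ZInv.eq_zero_of_forall_dvd hb fun N => ?_
    obtain ⟨c, hNc, hcb, h, hh, hv, hco, hd⟩ := H N
    refine ⟨c, hNc, hcb, ?_⟩
    obtain ⟨u, v, huv⟩ := natCast_dvd_adjoinRoot_mk_iff.mp hd
    have hE := mul_mem (hmem (k + 1)) hh
    have h₁ : (P ^ k * h).map (Int.castRingHom (ZInv b)) ∣ F (P ^ (k + 1) * h) := by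
      refine map_mul_dvd_of_isCoprime (monic_of_mem_cycMonoid (hmem _))
        (monic_of_mem_cycMonoid hh) ?_ ?_ ?_
      · rw [Polynomial.map_pow]
        exact hco.symm.pow_left
      · exact (hF.dvd_iff hE (hmem k)
          ((pow_dvd_pow P k.le_succ).trans (dvd_mul_right _ _))).mpr ih
      · exact (hF.dvd_iff hE hh (dvd_mul_left _ _)).mpr hv
    obtain ⟨G, hG⟩ := h₁
    have h₂ := hF _ hE _ (hmem (k + 1)) (dvd_mul_right _ _)
    -- Substitute `h = c u + P v` into `P ^ k h G`; the `v`-term is a multiple of `P ^ (k + 1)`.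
    have h₃ : (P ^ (k + 1)).map (Int.castRingHom (ZInv b)) ∣ F (P ^ (k + 1)) -
        (c : ZInv b) • (((P ^ k) * u).map (Int.castRingHom (ZInv b)) * G) := by
      rw [dvd_sub_comm] at h₂
      refine (dvd_iff_dvd_of_dvd_sub (a := (P ^ (k + 1)).map (Int.castRingHom (ZInv b))) ?_).mpr h₂
      refine ⟨v.map (Int.castRingHom (ZInv b)) * G, ?_⟩
      rw [hG, huv, smul_eq_C_mul]
      simp
      ring
    rw [modByMonic_eq_of_dvd_sub hQ h₃, smul_modByMonic, coeff_smul, smul_eq_mul]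
    exact dvd_mul_right _ _

/-- Vanishing at the orders `N t`, for infinitely many prime powers `t` coprime to `b`, implies
vanishing modulo all powers of `Φ_N`. -/
theorem IsCompatible.vanishes_cyclotomic_pow_of_infinite (hF : IsCompatible b S F) (hb : 0 < b)
    {N : ℕ+} (hN : N ∈ S) {T : Set ℕ+} (hT : T.Infinite)
    (hTp : ∀ t ∈ T, ∃ p k : ℕ, p.Prime ∧ ¬ p ∣ b ∧ k ≠ 0 ∧ (t : ℕ) = p ^ k)
    (hTS : ∀ t ∈ T, N * t ∈ S)
    (hTv : ∀ t ∈ T, Vanishes F (cyclotomic (N * t : ℕ+) ℤ)) (k : ℕ) :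
    Vanishes F (cyclotomic N ℤ ^ k) := by
  refine hF.vanishes_pow hb (cyclotomic_mem_cycMonoid hN) (fun C => ?_) k
  -- The primes under `C` elements of `T` may coincide, but their product is still at least `2 ^ C >
  -- C`.
  obtain ⟨s, hsT, hs⟩ := hT.exists_subset_card_eq C
  choose! p e hp hpb he hpe using hTp
  have hmem : ∀ t ∈ s, cyclotomic (N * t : ℕ+) ℤ ∈ cycMonoid S := fun t ht =>
    cyclotomic_mem_cycMonoid (hTS t (hsT ht))
  refine ⟨∏ t ∈ s, p t, ?_, ?_, ∏ t ∈ s, cyclotomic (N * t : ℕ+) ℤ, prod_mem hmem, ?_, ?_, ?_⟩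
  · refine (Nat.lt_two_pow_self (n := C)).trans_le ?_
    rw [← hs]
    exact Finset.pow_card_le_prod _ _ _ fun t ht => (hp t (hsT ht)).two_le
  · exact Nat.Coprime.prod_left fun t ht =>
      (Nat.Prime.coprime_iff_not_dvd (hp t (hsT ht))).mpr (hpb t (hsT ht))
  · refine hF.vanishes_prod hmem (fun t _ t' _ htt' => isCoprime_map_cyclotomic ?_)
      fun t ht => hTv t (hsT ht)
    exact fun h => htt' (mul_left_cancel (PNat.coe_injective h))
  · rw [Polynomial.map_prod]
    refine IsCoprime.prod_left fun t ht => isCoprime_map_cyclotomic ?_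
    have := Nat.one_lt_pow (he t (hsT ht)) (hp t (hsT ht)).one_lt
    rw [PNat.mul_coe, hpe t (hsT ht)]
    exact (lt_mul_of_one_lt_right N.pos this).ne'
  · rw [Nat.cast_prod, map_prod]
    refine Finset.prod_dvd_prod_of_dvd _ _ fun t ht => ?_
    rw [PNat.mul_coe, hpe t (hsT ht)]
    exact natCast_dvd_mk_cyclotomic_mul_prime_pow (hp t (hsT ht)) _ _

theorem IsCompatible.vanishes_cyclotomic_mul_prime_pow (hF : IsCompatible b S F) (hb : 0 < b)
    {n n' : ℕ+} (hn : n ∈ S) (hn' : n' ∈ S) {p : ℕ} (hp : p.Prime) (hpb : ¬ p ∣ b)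
    (hnp : (n' : ℕ) = n * p) (hv : ∀ k, Vanishes F (cyclotomic n ℤ ^ k)) (k : ℕ) :
    Vanishes F (cyclotomic n' ℤ ^ k) := by
  refine hF.vanishes_pow hb (cyclotomic_mem_cycMonoid hn') (fun C => ?_) k
  rw [hnp]
  obtain ⟨e, he⟩ := exists_natCast_dvd_mk_cyclotomic_pow hp n
  -- Since `p` divides `Φ_n ^ e` modulo `Φ_{n p}`, `p ^ C` divides `Φ_n ^ (e C)`; vanishing modulo
  -- all powers of `Φ_n` is needed here.
  refine ⟨p ^ C, Nat.lt_pow_self hp.one_lt,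
    ((Nat.Prime.coprime_iff_not_dvd hp).mpr hpb).pow_left _, cyclotomic n ℤ ^ (e * C),
    pow_mem (cyclotomic_mem_cycMonoid hn) _, hv _, ?_, ?_⟩
  · rw [Polynomial.map_pow]
    exact (isCoprime_map_cyclotomic (lt_mul_of_one_lt_right n.pos hp.one_lt).ne).pow_left
  · rw [pow_mul, map_pow, Nat.cast_pow]
    exact pow_dvd_pow_of_dvd he C

theorem IsCompatible.vanishes_cyclotomic_mul_pow (hF : IsCompatible b S F) (hb : 0 < b) {N : ℕ+}
    (hv : ∀ k, Vanishes F (cyclotomic N ℤ ^ k)) {m : ℕ+} (hm : (m : ℕ).Coprime b)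
    (hS : ∀ d : ℕ+, d ∣ m → N * d ∈ S) (k : ℕ) :
    Vanishes F (cyclotomic (N * m : ℕ+) ℤ ^ k) := by
  suffices H : ∀ d : ℕ, ∀ m : ℕ+, (m : ℕ) = d → (m : ℕ).Coprime b →
      (∀ d : ℕ+, d ∣ m → N * d ∈ S) → ∀ k, Vanishes F (cyclotomic (N * m : ℕ+) ℤ ^ k) from
    H m m rfl hm hS k
  intro d
  induction d using induction_on_primes with
  | zero => exact fun m hm => absurd hm m.ne_zero
  | one =>
    intro m hm _ _
    rw [PNat.coe_eq_one_iff.mp hm, mul_one]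
    exact hv
  | prime_mul p a hp ih =>
    intro m hm hmb hS
    have ha : 0 < a := Nat.pos_of_ne_zero fun h => m.ne_zero (by rw [hm, h, mul_zero])
    lift a to ℕ+ using ha
    have ham : a ∣ m := PNat.dvd_iff.mpr ⟨p, by rw [hm, mul_comm]⟩
    rw [hm] at hmb
    refine hF.vanishes_cyclotomic_mul_prime_pow hb (n := N * a) (hS _ ham)
      (hS _ dvd_rfl) hp ((Nat.Prime.coprime_iff_not_dvd hp).mp hmb.coprime_mul_right) ?_
      (ih a rfl hmb.coprime_mul_left fun d hd => hS d (hd.trans ham))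
    rw [PNat.mul_coe, PNat.mul_coe, hm]
    ring

theorem IsCompatible.vanishes_of_forall_cyclotomic_pow (hF : IsCompatible b S F)
    (hv : ∀ n ∈ S, ∀ k, Vanishes F (cyclotomic (n : ℕ) ℤ ^ k)) {h : ℤ[X]}
    (hh : h ∈ cycMonoid S) : Vanishes F h := by
  obtain ⟨e, he, rfl⟩ := exists_eq_prod_of_mem_cycMonoid hh
  refine hF.vanishes_prod (fun n hn => pow_mem (cyclotomic_mem_cycMonoid (he n hn)) _)
    (fun n _ m _ hnm => ?_) fun n hn => hv n (he n hn) _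
  simp only [Function.onFun, Polynomial.map_pow]
  exact (isCoprime_map_cyclotomic fun h => hnm (PNat.coe_injective h)).pow

end Residues

end CyclotomicCompletion

namespace CyclotomicCompletion

/-! ### From inverse limits to residues -/

section InverseLimit

variable {b : ℕ} {I : Type} [Preorder I] {J : I → Ideal (ZInv b)[X]} {hJ : Antitone J}

/-- Representatives of one element of an inverse limit, in two components, agree modulo every
common divisor of the moduli. -/
theorem map_dvd_sub_of_mk_eq [IsDirected I (· ≤ ·)] {G : I → ℤ[X]}
    (hG : ∀ i, J i = Ideal.span {(G i).map (Int.castRingHom (ZInv b))}) (x : inverseLimit J hJ)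
    {h : ℤ[X]} {i j : I} (hi : h ∣ G i) (hj : h ∣ G j) {F F' : (ZInv b)[X]}
    (hF : Ideal.Quotient.mk (J i) F = x.1 i) (hF' : Ideal.Quotient.mk (J j) F' = x.1 j) :
    h.map (Int.castRingHom (ZInv b)) ∣ F - F' := by
  obtain ⟨l, hil, hjl⟩ := exists_ge_ge i j
  obtain ⟨E, hE⟩ := Ideal.Quotient.mk_surjective (x.1 l)
  have key : ∀ (i : I) (F : (ZInv b)[X]), i ≤ l → h ∣ G i →
      Ideal.Quotient.mk (J i) F = x.1 i → h.map (Int.castRingHom (ZInv b)) ∣ E - F := by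
    intro i F hil hi hF
    have h₁ := x.2 i l hil
    rw [← hE, Ideal.Quotient.factor_mk, ← hF, Ideal.Quotient.mk_eq_mk_iff_sub_mem, hG,
      Ideal.mem_span_singleton] at h₁
    exact (Polynomial.map_dvd _ hi).trans h₁
  have := dvd_sub (key j F' hjl hj hF') (key i F hil hi hF)
  simpa using this

theorem aeval_eq_zero_of_evalThrough_eq_zero {ξ : ℂ} {i : I} {hi : ∀ f ∈ J i, aeval ξ f = 0}
    {x : inverseLimit J hJ} (hx : evalThrough hJ ξ i hi x = 0) {F : (ZInv b)[X]}
    (hF : Ideal.Quotient.mk (J i) F = x.1 i) : aeval ξ F = 0 := by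
  change Ideal.Quotient.lift (J i) _ hi (x.1 i) = 0 at hx
  rw [← hF] at hx
  exact hx

/-- `Φ_n` is the minimal polynomial of `ξ` over `ℚ`, so one primitive root per order suffices. -/
theorem map_cyclotomic_dvd_of_aeval_eq_zero {n : ℕ+} {ξ : ℂ} (hξ : IsPrimitiveRoot ξ n)
    {F : (ZInv b)[X]} (hF : aeval ξ F = 0) :
    (cyclotomic (n : ℕ) ℤ).map (Int.castRingHom (ZInv b)) ∣ F := by
  rw [map_intCast_dvd_iff (cyclotomic.monic _ _), map_cyclotomic,
    cyclotomic_eq_minpoly_rat hξ n.pos]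
  refine minpoly.dvd _ _ ?_
  rwa [aeval_map_algebraMap]

theorem cyclotomic_dvd_of_aeval_eq_zero {n : ℕ+} {ξ : ℂ} (hξ : IsPrimitiveRoot ξ n)
    {G : ℤ[X]} (hG : aeval ξ G = 0) : cyclotomic (n : ℕ) ℤ ∣ G := by
  rw [cyclotomic_eq_minpoly hξ n.pos]
  exact minpoly.isIntegrallyClosed_dvd (hξ.isIntegral n.pos) hG

/-- `x` is zero at the primitive `n`-th roots of unity, evaluated through some component. -/
def HasZeroAtOrder (x : inverseLimit J hJ) (n : ℕ+) : Prop :=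
  ∃ (ξ : ℂ) (_ : IsPrimitiveRoot ξ n) (i : I) (hi : ∀ f ∈ J i, aeval ξ f = 0),
    evalThrough hJ ξ i hi x = 0

/-- An element of `lim_i ℤ[1/b][q] / (G i)`, where the `G i` are cofinal with `Φ*_S`, vanishes if
each element of `S` is of the form `N m` such that `m` is coprime to `b`, `N d ∈ S` for all `d ∣ m`,
and `x` vanishes at the orders `N t` for infinitely many prime powers `t` coprime to `b`. -/
theorem inverseLimit_eq_zero [IsDirected I (· ≤ ·)] (hb : 0 < b) {G : I → ℤ[X]}
    (hG : ∀ i, J i = Ideal.span {(G i).map (Int.castRingHom (ZInv b))}) {S : Set ℕ+}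
    (hSG : ∀ h ∈ cycMonoid S, ∃ i, h ∣ G i) (hGS : ∀ i, ∃ h ∈ cycMonoid S, G i ∣ h)
    (x : inverseLimit J hJ)
    (H : ∀ n ∈ S, ∃ N m : ℕ+, n = N * m ∧ (m : ℕ).Coprime b ∧ (∀ d, d ∣ m → N * d ∈ S) ∧
      ∃ T : Set ℕ+, T.Infinite ∧
        (∀ t ∈ T, ∃ p k : ℕ, p.Prime ∧ ¬ p ∣ b ∧ k ≠ 0 ∧ (t : ℕ) = p ^ k) ∧
        ∀ t ∈ T, N * t ∈ S ∧ HasZeroAtOrder x (N * t)) :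
    x = 0 := by
  have : Nonempty I := (hSG 1 (one_mem _)).nonempty
  choose! i hi using hSG
  choose! F hF using fun h : ℤ[X] => Ideal.Quotient.mk_surjective (x.1 (i h))
  have hcomp : IsCompatible b S F := fun h hh h' hh' hd =>
    map_dvd_sub_of_mk_eq hG x (hd.trans (hi h hh)) (hi h' hh') (hF h) (hF h')
  have hzero : ∀ n ∈ S, HasZeroAtOrder x n → Vanishes F (cyclotomic (n : ℕ) ℤ) := by
    rintro n hn ⟨ξ, hξ, j, hj, hx⟩
    obtain ⟨E, hE⟩ := Ideal.Quotient.mk_surjective (x.1 j)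
    have h₁ := map_cyclotomic_dvd_of_aeval_eq_zero hξ (aeval_eq_zero_of_evalThrough_eq_zero hx hE)
    -- Evaluation at `ξ` factors through component `j`, so the generator of `J j` itself vanishes at
    -- `ξ`.
    have h₂ : cyclotomic (n : ℕ) ℤ ∣ G j := by
      refine cyclotomic_dvd_of_aeval_eq_zero hξ ?_
      have := hj ((G j).map (Int.castRingHom (ZInv b))) (by
        rw [hG]
        exact Ideal.mem_span_singleton_self _)
      rw [← aeval_map_algebraMap (ZInv b)]
      exact this
    exact (dvd_iff_dvd_of_dvd_sub (map_dvd_sub_of_mk_eq hG x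
      (hi _ (cyclotomic_mem_cycMonoid hn)) h₂ (hF _) hE)).mpr h₁
  have hvan : ∀ h ∈ cycMonoid S, Vanishes F h := fun h hh => by
    refine hcomp.vanishes_of_forall_cyclotomic_pow (fun n hn => ?_) hh
    obtain ⟨N, m, rfl, hm, hS, T, hT, hTp, hTx⟩ := H n hn
    refine hcomp.vanishes_cyclotomic_mul_pow hb ?_ hm hS
    refine hcomp.vanishes_cyclotomic_pow_of_infinite hb ?_ hT hTp (fun t ht => (hTx t ht).1)
      fun t ht => hzero _ (hTx t ht).1 (hTx t ht).2
    simpa using hS 1 (one_dvd m)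
  refine Subtype.ext (funext fun j => ?_)
  obtain ⟨E, hE⟩ := Ideal.Quotient.mk_surjective (x.1 j)
  obtain ⟨h, hh, hd⟩ := hGS j
  have h₁ := map_dvd_sub_of_mk_eq hG x dvd_rfl (hd.trans (hi h hh)) hE (hF h)
  have h₂ := (dvd_iff_dvd_of_dvd_sub h₁).mpr ((Polynomial.map_dvd _ hd).trans (hvan h hh))
  have h₃ : Ideal.Quotient.mk (J j) E = 0 := by
    rw [Ideal.Quotient.eq_zero_iff_mem, hG]
    exact Ideal.mem_span_singleton.mpr h₂
  exact hE.symm.trans h₃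

end InverseLimit

/-! ### Cofinality of the Pochhammer products in `Φ*_S` -/

section Cofinality

instance (S : Set ℕ+) : IsDirected (cycMonoid S) (· ≤ ·) :=
  ⟨fun f g => ⟨f * g, Dvd.intro _ rfl, Dvd.intro_left _ rfl⟩⟩

variable {S : Set ℕ+} {a : ℕ → ℕ}

theorem exists_dvd_prod_one_sub_X_pow (ha : ∀ n ∈ S, ∀ K, ∃ j, K ≤ j ∧ (n : ℕ) ∣ a j)
    {h : ℤ[X]} (hh : h ∈ cycMonoid S) :
    ∃ k, h ∣ ∏ j ∈ Finset.range k, (1 - (X : ℤ[X]) ^ a j) := by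
  -- The factors with index below `K` are kept in reserve, so that the two halves of a product use
  -- disjoint ranges of indices.
  suffices H : ∀ K, ∃ k, (∏ j ∈ Finset.range K, (1 - (X : ℤ[X]) ^ a j)) * h ∣
      ∏ j ∈ Finset.range k, (1 - (X : ℤ[X]) ^ a j) by
    simpa using H 0
  induction hh using Submonoid.closure_induction with
  | mem x hx =>
    obtain ⟨n, hn, rfl⟩ := hx
    intro K
    obtain ⟨j, hKj, hj⟩ := ha n hn K
    refine ⟨j + 1, ?_⟩
    rw [Finset.prod_range_succ]
    refine mul_dvd_mul (Finset.prod_dvd_prod_of_subset _ _ _ (Finset.range_mono hKj)) ?_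
    rw [← dvd_neg, neg_sub]
    refine (cyclotomic.dvd_X_pow_sub_one _ _).trans ?_
    obtain ⟨d, hd⟩ := hj
    rw [hd, pow_mul]
    exact sub_one_dvd_pow_sub_one _ _
  | one => exact fun K => ⟨K, by simp⟩
  | mul x y _ _ hx hy =>
    intro K
    obtain ⟨k, hk⟩ := hx K
    obtain ⟨l, hl⟩ := hy k
    refine ⟨l, ?_⟩
    rw [← mul_assoc]
    exact (mul_dvd_mul_right hk y).trans hl

theorem exists_prod_one_sub_X_pow_dvd (ha : ∀ j, 0 < a j)
    (haS : ∀ j, ∀ n : ℕ+, (n : ℕ) ∣ a j → n ∈ S) (k : ℕ) :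
    ∃ h ∈ cycMonoid S, ∏ j ∈ Finset.range k, (1 - (X : ℤ[X]) ^ a j) ∣ h := by
  -- The sign is changed because `X ^ a - 1`, a product of the `Φ_d` with `d ∣ a`, is the one that
  -- lies in the monoid.
  refine ⟨∏ j ∈ Finset.range k, (X ^ a j - 1), prod_mem fun j _ => ?_,
    Finset.prod_dvd_prod_of_dvd _ _ fun j _ => ?_⟩
  · rw [← prod_cyclotomic_eq_X_pow_sub_one (ha j)]
    refine prod_mem fun d hd => ?_
    exact cyclotomic_mem_cycMonoid (n := ⟨d, Nat.pos_of_mem_divisors hd⟩)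
      (haS j _ (Nat.dvd_of_mem_divisors hd))
  · rw [← neg_dvd, neg_sub]

end Cofinality

/-! ### Arithmetic of the index sets -/

section Arithmetic

theorem exists_eq_mul_coprime (b : ℕ) {n : ℕ} (hn : n ≠ 0) :
    ∃ N m r : ℕ, n = N * m ∧ N ∣ b ^ r ∧ m.Coprime b := by
  induction n using induction_on_primes with
  | zero => exact absurd rfl hn
  | one => exact ⟨1, 1, 0, by simp⟩
  | prime_mul p a hp ih =>
    obtain ⟨N, m, r, rfl, hN, hm⟩ := ih (right_ne_zero_of_mul hn)
    by_cases hpb : p ∣ b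
    · exact ⟨p * N, m, r + 1, by ring, by rw [pow_succ']; exact mul_dvd_mul hpb hN, hm⟩
    · exact ⟨N, p * m, r, by ring, hN,
        Nat.Coprime.mul_left ((Nat.Prime.coprime_iff_not_dvd hp).mpr hpb) hm⟩

theorem oddPrimePower_pos (b : ℕ) (e : ℕ → ℕ) : 0 < oddPrimePower b e :=
  Finset.prod_pos fun _ hl =>
    pow_pos (Nat.prime_of_mem_primeFactors (Finset.mem_of_mem_erase hl)).pos _

theorem mem_set_of_mem {b : ℕ} {e : ℕ → ℕ} {S : Set ℕ+} (hS : S = setO b e ∨ S = setA b e)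
    {n : ℕ+} (hn : n ∈ S) : ∃ m : ℕ+, (n : ℕ) = oddPrimePower b e * m ∧ (m : ℕ).Coprime b ∧
      ∀ n' d : ℕ+, d ∣ m → (n' : ℕ) = oddPrimePower b e * d → n' ∈ S := by
  rcases hS with rfl | rfl
  · obtain ⟨m, hm, h⟩ := hn
    exact ⟨m, h, (Nat.Coprime.coprime_mul_left hm).symm, fun n' d hd h' =>
      ⟨d, Nat.Coprime.coprime_dvd_right (PNat.dvd_iff.mp hd) hm, h'⟩⟩
  · obtain ⟨m, hm, h⟩ := hn
    exact ⟨m, h, Nat.Coprime.symm hm, fun n' d hd h' =>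
      ⟨d, Nat.Coprime.coprime_dvd_right (PNat.dvd_iff.mp hd) hm, h'⟩⟩

theorem mem_set_of_eq_mul_prime_pow {b : ℕ} {e : ℕ → ℕ} {S : Set ℕ+}
    (hS : S = setO b e ∨ S = setA b e) {p k : ℕ} (hp : p.Prime) (hp2 : Odd p) (hpb : ¬ p ∣ b)
    {n t : ℕ+} (ht : (t : ℕ) = p ^ k) (hn : (n : ℕ) = oddPrimePower b e * t) : n ∈ S := by
  have h₁ : Nat.Coprime b t := by
    rw [ht]
    exact (((Nat.Prime.coprime_iff_not_dvd hp).mpr hpb).pow_left k).symm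
  rcases hS with rfl | rfl
  · refine ⟨t, Nat.Coprime.mul_left ?_ h₁, hn⟩
    rw [ht]
    exact (hp2.coprime_two_left).pow_right k
  · exact ⟨t, h₁, hn⟩

/-- The infinite sets of powers of one prime and the infinite sets of primes both consist, up to
the power `1`, of prime powers. -/
theorem exists_infinite_prime_powers {b : ℕ} {T : Set ℕ}
    (hT : IsInfinitePowerSet b T ∨ IsInfinitePrimeSet b T) :
    ∃ T' : Set ℕ+, T'.Infinite ∧ ∀ t ∈ T', (t : ℕ) ∈ T ∧
      ∃ p k : ℕ, p.Prime ∧ Odd p ∧ ¬ p ∣ b ∧ k ≠ 0 ∧ (t : ℕ) = p ^ k := by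
  have hinf : T.Infinite := hT.elim (fun h => h.1) fun h => h.1
  -- The trivial power `1` is discarded: `Φ_{N t}` must be coprime to `Φ_N`.
  have hpp : ∀ t ∈ T \ {1}, ∃ p k : ℕ, p.Prime ∧ Odd p ∧ ¬ p ∣ b ∧ k ≠ 0 ∧ t = p ^ k := by
    rintro t ⟨ht, ht1⟩
    rcases hT with ⟨-, p, hp, hp2, hpb, h⟩ | ⟨-, h⟩
    · obtain ⟨k, rfl⟩ := h t ht
      exact ⟨p, k, hp, hp2, hpb, fun hk => ht1 (by simp [hk]), rfl⟩
    · obtain ⟨hp, hp2, hpb⟩ := h t ht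
      exact ⟨t, 1, hp, hp2, hpb, one_ne_zero, (pow_one t).symm⟩
  refine ⟨PNat.val ⁻¹' (T \ {1}), ?_, fun t ht => ⟨ht.1, hpp t ht⟩⟩
  refine (hinf.sdiff (Set.finite_singleton 1)).preimage fun t ht => ?_
  obtain ⟨p, k, hp, -, -, -, rfl⟩ := hpp t ht
  exact ⟨⟨p ^ k, pow_pos hp.pos k⟩, rfl⟩

theorem infinite_positive_powers {p : ℕ} (hp : p.Prime) :
    {t : ℕ+ | ∃ k : ℕ, k ≠ 0 ∧ (t : ℕ) = p ^ k}.Infinite := by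
  refine Set.infinite_of_injective_forall_mem
    (f := fun k : ℕ => (⟨p ^ (k + 1), pow_pos hp.pos _⟩ : ℕ+)) (fun k l h => ?_)
    fun k => ⟨k + 1, k.succ_ne_zero, rfl⟩
  have := Nat.pow_right_injective hp.two_le (congrArg PNat.val h)
  simpa using this

end Arithmetic

/-! ### Injectivity for the completions, `R_b` and `S_b` -/

section Injectivity

variable {b : ℕ}

theorem Completion.eq_zero_of_ev_eq_zero (hb : 0 < b) {e : ℕ → ℕ} {S : Set ℕ+}
    (hS : S = setO b e ∨ S = setA b e) {T : Set ℕ}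
    (hT : IsInfinitePowerSet b T ∨ IsInfinitePrimeSet b T) {x : Completion (ZInv b) S}
    (hx : ∀ (n : ℕ+) (hn : n ∈ S) (ξ : ℂ) (hξ : IsPrimitiveRoot ξ n),
      (∃ t ∈ T, (n : ℕ) = oddPrimePower b e * t) → Completion.ev hn hξ x = 0) : x = 0 := by
  obtain ⟨T', hT', hTp⟩ := exists_infinite_prime_powers hT
  refine inverseLimit_eq_zero hb (G := fun f : cycMonoid S => (f : ℤ[X])) (fun _ => rfl)
    (fun h hh => ⟨⟨h, hh⟩, dvd_rfl⟩) (fun f => ⟨f, f.2, dvd_rfl⟩) x fun n hn => ?_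
  obtain ⟨m, hnm, hm, hd⟩ := mem_set_of_mem hS hn
  refine ⟨⟨_, oddPrimePower_pos b e⟩, m, PNat.eq hnm, hm, fun d hdm => hd _ d hdm rfl, T', hT',
    fun t ht => ?_, fun t ht => ?_⟩
  · obtain ⟨-, p, k, hp, -, hpb, hk, h⟩ := hTp t ht
    exact ⟨p, k, hp, hpb, hk, h⟩
  · obtain ⟨htT, p, k, hp, hp2, hpb, hk, h⟩ := hTp t ht
    have hmem : (⟨_, oddPrimePower_pos b e⟩ * t : ℕ+) ∈ S :=
      mem_set_of_eq_mul_prime_pow hS hp hp2 hpb h rfl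
    have hξ := Complex.isPrimitiveRoot_exp _ (⟨_, oddPrimePower_pos b e⟩ * t : ℕ+).ne_zero
    exact ⟨hmem, _, hξ, _, _, hx _ hmem _ hξ ⟨t, htT, rfl⟩⟩

/-- The common part of the injectivity statements for `R_b` and `S_b`. -/
theorem inverseLimit_eq_zero_of_orderSet (hb : 0 < b) {J : ℕ → Ideal (ZInv b)[X]}
    {hJ : Antitone J} {a : ℕ → ℕ}
    (hJa : ∀ k, J k = Ideal.span {∏ j ∈ Finset.range k, (1 - (X : (ZInv b)[X]) ^ a j)})
    {S : Set ℕ+} (ha : ∀ j, 0 < a j) (haS : ∀ j, ∀ n : ℕ+, (n : ℕ) ∣ a j → n ∈ S)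
    (hSa : ∀ n ∈ S, ∀ K, ∃ j, K ≤ j ∧ (n : ℕ) ∣ a j) (hSd : ∀ n ∈ S, ∀ d, d ∣ n → d ∈ S)
    {p : ℕ} (hp : p.Prime) (hpb : ¬ p ∣ b)
    (hSp : ∀ n ∈ S, ∀ n' : ℕ+, (∃ k, (n' : ℕ) = n * p ^ k) → n' ∈ S)
    (hSb : ∀ n ∈ S, ∀ r, (n : ℕ) ∣ b ^ r → Odd (n : ℕ)) {x : inverseLimit J hJ}
    (hx : ∀ n ∈ S, (n : ℕ) ∈ orderSet p b → HasZeroAtOrder x n) : x = 0 := by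
  refine inverseLimit_eq_zero hb (G := fun k => ∏ j ∈ Finset.range k, (1 - (X : ℤ[X]) ^ a j))
    (fun k => by simp [hJa, Polynomial.map_prod])
    (fun h hh => exists_dvd_prod_one_sub_X_pow hSa hh) (exists_prod_one_sub_X_pow_dvd ha haS) x
    fun n hn => ?_
  -- `N` supplies the factor `b'` in the orders `p ^ k * b'`, whence the requirement that it be odd.
  obtain ⟨N, m, r, hnm, hN, hm⟩ := exists_eq_mul_coprime b n.ne_zero
  have hNm : 0 < N * m := hnm ▸ n.pos
  lift N to ℕ+ using Nat.pos_of_mul_pos_right hNm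
  lift m to ℕ+ using Nat.pos_of_mul_pos_left hNm
  obtain rfl : n = N * m := PNat.eq hnm
  have hNS := hSd _ hn N (dvd_mul_right N m)
  refine ⟨N, m, rfl, hm, fun d hd => hSd _ hn _ (mul_dvd_mul_left N hd), _,
    infinite_positive_powers hp, ?_, ?_⟩
  · rintro t ⟨k, hk, ht⟩
    exact ⟨p, k, hp, hpb, hk, ht⟩
  · rintro t ⟨k, hk, ht⟩
    have hmem : N * t ∈ S := hSp N hNS _ ⟨k, by rw [PNat.mul_coe, ht]⟩
    refine ⟨hmem, hx _ hmem ⟨k, N, hSb N hNS r hN, ⟨r, hN⟩, ?_⟩⟩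
    rw [PNat.mul_coe, ht, mul_comm]

theorem RRing.eq_zero_of_ev_eq_zero (hb : 0 < b) {p : ℕ} (hp : p.Prime) (hp2 : Odd p)
    (hpb : ¬ p ∣ b) {x : RRing b}
    (hx : ∀ (n : ℕ+) (hn : Odd (n : ℕ)) (ξ : ℂ) (hξ : IsPrimitiveRoot ξ n),
      (n : ℕ) ∈ orderSet p b → RRing.ev b hn hξ x = 0) : x = 0 := by
  refine inverseLimit_eq_zero_of_orderSet hb (a := fun j => 2 * j + 1)
    (S := {n : ℕ+ | Odd (n : ℕ)}) (fun k => ?_) (fun j => Nat.succ_pos _)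
    (fun j n hn => Odd.of_dvd_nat ⟨j, rfl⟩ hn) (fun n hn K => ?_)
    (fun n hn d hd => Odd.of_dvd_nat hn (PNat.dvd_iff.mp hd)) hp hpb ?_ (fun n hn _ _ => hn)
    fun n hn ho => ?_
  · congr! 3
    refine Finset.prod_congr rfl fun j _ => ?_
    ring
  · obtain ⟨l, hl⟩ : Odd (n : ℕ) := hn
    -- With `n = 2 l + 1`, this index satisfies `2 j + 1 = n (2 K + 1)`.
    refine ⟨n * K + l, (Nat.le_mul_of_pos_left K n.pos).trans (Nat.le_add_right _ _),
      2 * K + 1, ?_⟩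
    rw [show 2 * (n * K + l) + 1 = 2 * (n * K) + (2 * l + 1) by ring, ← hl]
    ring
  · rintro n hn n' ⟨k, hk⟩
    change Odd (n' : ℕ)
    rw [hk]
    exact Odd.mul hn hp2.pow
  · have hξ := Complex.isPrimitiveRoot_exp _ n.ne_zero
    exact ⟨_, hξ, _, _, hx n hn _ hξ ho⟩

theorem SRing.eq_zero_of_ev_eq_zero (hb : 0 < b) (hb2 : Odd b) {p : ℕ} (hp : p.Prime)
    (hpb : ¬ p ∣ b) {x : SRing b}
    (hx : ∀ (n : ℕ+) (ξ : ℂ) (hξ : IsPrimitiveRoot ξ n),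
      (n : ℕ) ∈ orderSet p b → SRing.ev b hξ x = 0) : x = 0 := by
  refine inverseLimit_eq_zero_of_orderSet hb (a := fun j => j + 1) (S := Set.univ) (fun k => ?_)
    (fun j => Nat.succ_pos _) (fun _ _ _ => Set.mem_univ _) (fun n _ K => ?_)
    (fun _ _ _ _ => Set.mem_univ _) hp hpb (fun _ _ _ _ => Set.mem_univ _)
    -- Here oddness of `b` enters: orders may be even, but divisors of `b ^ r` are odd.
    (fun n _ r hn => Odd.of_dvd_nat hb2.pow hn) fun n _ ho => ?_
  · congr! 3
    refine Finset.prod_congr rfl fun j _ => ?_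
    ring
  · refine ⟨n * (K + 1) - 1, Nat.le_sub_one_of_lt (Nat.le_mul_of_pos_left _ n.pos), K + 1, ?_⟩
    exact Nat.sub_add_cancel (Nat.mul_pos n.pos K.succ_pos)
  · have hξ := Complex.isPrimitiveRoot_exp _ n.ne_zero
    exact ⟨_, hξ, _, _, hx n _ hξ ho⟩

end Injectivity

end CyclotomicCompletion

theorem mainTheorem8 (b : ℕ) (hb : 0 < b) :
    -- the components of the decompositions of `R_b` and `S_b`
    (∀ (e : ℕ → ℕ) (S : Set ℕ+), S = setO b e ∨ S = setA b e →
      ∀ T : Set ℕ, IsInfinitePowerSet b T ∨ IsInfinitePrimeSet b T →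
        ∀ f g : Completion (ZInv b) S,
          (∀ (n : ℕ+) (hn : n ∈ S) (ξ : ℂ) (hξ : IsPrimitiveRoot ξ n),
            (∃ t ∈ T, (n : ℕ) = oddPrimePower b e * t) →
              Completion.ev hn hξ f = Completion.ev hn hξ g) →
          f = g) ∧
    (∀ p : ℕ, p.Prime → Odd p → ¬ p ∣ b →
      -- the ring `R_b`
      (∀ f g : RRing b,
        (∀ (n : ℕ+) (hn : Odd (n : ℕ)) (ξ : ℂ) (hξ : IsPrimitiveRoot ξ n),
          (n : ℕ) ∈ orderSet p b → RRing.ev b hn hξ f = RRing.ev b hn hξ g) →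
        f = g) ∧
      -- the ring `S_b`, for odd `b`
      (Odd b → ∀ f g : SRing b,
        (∀ (n : ℕ+) (ξ : ℂ) (hξ : IsPrimitiveRoot ξ n),
          (n : ℕ) ∈ orderSet p b → SRing.ev b hξ f = SRing.ev b hξ g) →
        f = g)) := by
  refine ⟨fun e S hS T hT f g h => ?_, fun p hp hp2 hpb =>
    ⟨fun f g h => ?_, fun hb2 f g h => ?_⟩⟩
  · refine sub_eq_zero.mp (Completion.eq_zero_of_ev_eq_zero hb hS hT fun n hn ξ hξ ht => ?_)
    rw [map_sub, h n hn ξ hξ ht, sub_self]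
  · refine sub_eq_zero.mp (RRing.eq_zero_of_ev_eq_zero hb hp hp2 hpb fun n hn ξ hξ ht => ?_)
    rw [map_sub, h n hn ξ hξ ht, sub_self]
  · refine sub_eq_zero.mp (SRing.eq_zero_of_ev_eq_zero hb hb2 hp hpb fun n ξ hξ ht => ?_)
    rw [map_sub, h n ξ hξ ht, sub_self]
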